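/- Let $k$ be a field of characteristic $p>0$. A variety over $k$ is an integral scheme that is separated and of finite type over $k$. For an integral scheme $Z$, $K(Z)$ denotes its function field. Let $X$ be a variety over $k$ such that $k$ is algebraically closed in $K(X)$. A pair $(k\subset l\subset k',\ \varphi:X'\to X)$, consisting of field extensions $k\subset l\subset k'$ and a morphism $\varphi$ of schemes, is an elemental extension of $(k,X)$ if: $k\subset l$ is purely inseparable with $l^p\subset k$, and $X\times_k l$ is integral; $X'$ is the normalisation of $X\times_k l$; $\varphi$ is the induced morphism $X'\to X\times_k l\to X$; and $k'$ is the algebraic closure of $l$ in $K(X')$. Proposition. Let $f:X\to Y$ be a proper $k$-morphism of normal varieties over $k$ such that $f_*\mathcal O_X=\mathcal O_Y$ and $k$ is algebraically closed in $K(Y)$. Then $k$ is algebraically closed in $K(X)$. Let $(k\subset l\subset k_{X'},\ \varphi:X'\to X)$ be an elemental extension of $(k,X)$. Then: (1) $Y\times_k l$ is an integral scheme. Furthermore, let $Y'\to Y\times_k l$ be the normalisation of $Y\times_k l$, let $\psi:Y'\to Y$ be the induced morphism, and let $k_{Y'}$ be the algebraic closure of $l$ in $K(Y')$. Then: (2)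 $(k\subset l\subset k_{Y'},\ \psi:Y'\to Y)$ is an elemental extension of $(k,Y)$. (3) There is a dominant morphism $f':X'\to Y'$ compatible with $f\times_k l:X\times_k l\to Y\times_k l$, and under the induced inclusion $K(Y')\subset K(X')$ one has $l\subset k_{Y'}\subset k_{X'}$. (4) If $Y\times_k l$ is not normal, then $X\times_k l$ is not normal. -/

import Mathlib

open AlgebraicGeometry CategoryTheory CategoryTheory.Limits

universe u

namespace ElementalExt

noncomputable section

/-- A scheme is normal if all its local rings are integrally closed domains. -/
structure IsNormalScheme (X : Scheme.{u}) : Prop where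
  isDomain_stalk : ∀ x : X, IsDomain (X.presheaf.stalk x)
  isIntegrallyClosed_stalk : ∀ x : X, IsIntegrallyClosed (X.presheaf.stalk x)

/-- `f_* 𝒪_X = 𝒪_Y`: the canonical map `𝒪_Y → f_* 𝒪_X` is an isomorphism. -/
def PushforwardStructureSheafEq {X Y : Scheme.{u}} (f : X ⟶ Y) : Prop :=
  ∀ U : Y.Opens, Function.Bijective (f.app U).hom

/-- The ring homomorphism `k → K(X)` given by a `k`-scheme structure on an integral scheme. -/
def toFunctionField {k : Type u} [Field k] {X : Scheme.{u}} [IsIntegral X]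
    (s : X ⟶ Spec (.of k)) : k →+* X.functionField :=
  ((Scheme.ΓSpecIso (.of k)).inv ≫ s.appTop ≫
    X.presheaf.germ ⊤ (genericPoint X) trivial).hom

/-- A dominant morphism of integral schemes sends the generic point to the generic point. -/
theorem map_genericPoint {X Y : Scheme.{u}} [IsIntegral X] [IsIntegral Y] (f : X ⟶ Y)
    [IsDominant f] : f (genericPoint X) = genericPoint Y := by
  have h : IsGenericPoint (f (genericPoint X)) (closure (f '' Set.univ)) :=
    (genericPoint_spec X).image f.continuous
  rw [Set.image_univ, f.denseRange.closure_range] at h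
  exact h.eq (genericPoint_spec Y)

/-- The map `K(Y) → K(X)` induced by a dominant morphism `X ⟶ Y` of integral schemes. -/
def functionFieldMap {X Y : Scheme.{u}} [IsIntegral X] [IsIntegral Y] (f : X ⟶ Y)
    [IsDominant f] : Y.functionField →+* X.functionField :=
  (Y.presheaf.stalkSpecializes (specializes_of_eq (map_genericPoint f)) ≫
    f.stalkMap (genericPoint X)).hom

/-- `x` is algebraic over the field `F` with respect to `a : F → K`. -/
def AlgebraicElem {F K : Type*} [Field F] [Field K] (a : F →+* K) (x : K) : Prop :=
  ∃ q : Polynomial F, q ≠ 0 ∧ q.eval₂ a x = 0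

/-- `F` is algebraically closed in `K`. -/
def AlgebraicallyClosedIn {F K : Type*} [Field F] [Field K] (a : F →+* K) : Prop :=
  ∀ x : K, AlgebraicElem a x → x ∈ a.range

/-- The extension `E` of `F`, embedded in `K` by the `F`-homomorphism `ι`, is the algebraic
closure of `F` in `K`. -/
structure IsAlgebraicClosureIn {F E K : Type*} [Field F] [Field E] [Field K] [Algebra F E]
    (a : F →+* K) (ι : E →+* K) : Prop where
  comp_algebraMap : ι.comp (algebraMap F E) = a
  mem_range_iff : ∀ x : K, x ∈ ι.range ↔ AlgebraicElem a x

/-- `ν : Z' ⟶ Z` is the normalisation of the integral scheme `Z`: the scheme `Z'` is integral and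
normal, and `ν` is an integral, dominant morphism inducing an isomorphism of function fields
(by dominance, `ν` sends the generic point of `Z'` to that of `Z`). -/
structure IsNormalisation {Z' Z : Scheme.{u}} [IsIntegral Z'] (ν : Z' ⟶ Z) : Prop where
  isIntegral : IsIntegral Z
  isNormalScheme : IsNormalScheme Z'
  isIntegralHom : IsIntegralHom ν
  isDominant : IsDominant ν
  bijective_functionField : Function.Bijective (ν.stalkMap (genericPoint Z')).hom

section BaseChange

variable {k : Type u} [Field k] (l : Type u) [Field l] [Algebra k l]

/-- The scheme `X ×_k l`. -/
abbrev baseChange {X : Scheme.{u}} (s : X ⟶ Spec (.of k)) : Scheme.{u} :=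
  pullback s (Spec.map (CommRingCat.ofHom (algebraMap k l)))

/-- The projection `X ×_k l ⟶ X`. -/
abbrev baseChangeFst {X : Scheme.{u}} (s : X ⟶ Spec (.of k)) : baseChange l s ⟶ X :=
  pullback.fst _ _

/-- The structure morphism `X ×_k l ⟶ Spec l`. -/
abbrev baseChangeSnd {X : Scheme.{u}} (s : X ⟶ Spec (.of k)) :
    baseChange l s ⟶ Spec (.of l) :=
  pullback.snd _ _

/-- The morphism `f ×_k l : X ×_k l ⟶ Y ×_k l` induced by a `k`-morphism `f`. -/
def baseChangeMap {X Y : Scheme.{u}} {sX : X ⟶ Spec (.of k)} {sY : Y ⟶ Spec (.of k)}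
    (f : X ⟶ Y) (hf : f ≫ sY = sX) : baseChange l sX ⟶ baseChange l sY :=
  pullback.lift (baseChangeFst l sX ≫ f) (baseChangeSnd l sX)
    (by rw [Category.assoc, hf, pullback.condition])

end BaseChange

/-- `(k ⊂ l ⊂ k', φ : X' ⟶ X)` is an elemental extension of `(k, X)`, where `s` is the structure
morphism of the `k`-variety `X`, `ν : X' ⟶ X ×_k l` is the morphism through which `φ` factors,
and `ι : k' → K(X')` is the inclusion. The standing assumptions that `X` is a variety and that `k`
is algebraically closed in `K(X)` are not repeated here. -/
structure IsElementalExtension (p : ℕ) {k l k' : Type u} [Field k] [Field l] [Field k']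
    [Algebra k l] [Algebra l k'] {X X' : Scheme.{u}} [IsIntegral X'] (s : X ⟶ Spec (.of k))
    (φ : X' ⟶ X) (ν : X' ⟶ baseChange l s) (ι : k' →+* X'.functionField) : Prop where
  isPurelyInseparable : IsPurelyInseparable k l
  pow_mem : ∀ x : l, x ^ p ∈ (algebraMap k l).range
  isIntegral_baseChange : IsIntegral (baseChange l s)
  isNormalisation : IsNormalisation ν
  eq_induced : φ = ν ≫ baseChangeFst l s
  isAlgebraicClosureIn :
    IsAlgebraicClosureIn (toFunctionField (ν ≫ baseChangeSnd l s)) ι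

end

end ElementalExt

/-!
Flat base change along `k ⊂ l` turns `f_* 𝒪_X = 𝒪_Y` into the same equality for
`X ×_k l ⟶ Y ×_k l`: the sections over an open subset of `Y ×_k l` are those over its preimage.
Hence `Y ×_k l` inherits integrality and normality from `X ×_k l`. Likewise, an element of `K(X)`
algebraic over `k` is integral over `Γ(X, ⊤)`, so it is a global section of the normal scheme `X`,
and therefore comes from a global section of `Y`.

A normal integral scheme is its own relative normalisation in its function field. By the universal
property of relative normalisation, the dominant morphism `X' ⟶ Y ×_k l` lifts along the integral
morphism `Y' ⟶ Y ×_k l` as soon as it does so at the generic point, where `Y'` and `Y ×_k l` agree.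
-/

namespace ElementalExt

open TopologicalSpace

section AlgebraicElements

variable {F K : Type*} [Field F] [Field K] {a : F →+* K}

theorem algebraicElem_iff_isIntegralElem {x : K} : AlgebraicElem a x ↔ a.IsIntegralElem x := by
  constructor
  · rintro ⟨q, hq, hqx⟩
    exact ⟨q * Polynomial.C q.leadingCoeff⁻¹, Polynomial.monic_mul_leadingCoeff_inv hq, by
      rw [Polynomial.eval₂_mul, hqx, zero_mul]⟩
  · rintro ⟨q, hq, hqx⟩
    exact ⟨q, hq.ne_zero, hqx⟩

theorem algebraicElem_map_iff {L : Type*} [Field L] (m : K →+* L) {x : K} :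
    AlgebraicElem (m.comp a) (m x) ↔ AlgebraicElem a x := by
  simp only [algebraicElem_iff_isIntegralElem, RingHom.IsIntegralElem.map_iff m.injective]

theorem IsAlgebraicClosureIn.exists_algHom {E E' K' : Type*} [Field E] [Field E'] [Field K']
    [Algebra F E] [Algebra F E'] {ι : E →+* K} {m : K →+* K'} {ι' : E' →+* K'}
    (h : IsAlgebraicClosureIn a ι) (h' : IsAlgebraicClosureIn (m.comp a) ι') :
    ∃ j : E →ₐ[F] E', ∀ x, ι' (j x) = m (ι x) := by
  have hmem (x : E) : m (ι x) ∈ ι'.range :=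
    (h'.mem_range_iff _).mpr ((algebraicElem_map_iff m).mpr ((h.mem_range_iff _).mp ⟨x, rfl⟩))
  let e : E' ≃+* ι'.range :=
    .ofBijective ι'.rangeRestrict ⟨ι'.rangeRestrict.injective, ι'.rangeRestrict_surjective⟩
  let j : E →+* E' := (e.symm : ι'.range →+* E').comp ((m.comp ι).codRestrict ι'.range hmem)
  have hj (x : E) : ι' (j x) = m (ι x) := congrArg Subtype.val (e.apply_symm_apply _)
  refine ⟨{ j with commutes' := fun c ↦ ι'.injective ?_ }, hj⟩
  calc ι' (j (algebraMap F E c)) = m (ι (algebraMap F E c)) := hj _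
    _ = m (a c) := congrArg m (RingHom.congr_fun h.comp_algebraMap c)
    _ = ι' (algebraMap F E' c) := (RingHom.congr_fun h'.comp_algebraMap c).symm

end AlgebraicElements

section FunctionFieldMap

variable {X Y : Scheme.{u}} (f : X ⟶ Y)

theorem isDominant_of_apply_eq_genericPoint [IrreducibleSpace Y] {x : X}
    (hx : f x = genericPoint Y) : IsDominant f := by
  refine ⟨dense_iff_closure_eq.mpr (Set.univ_subset_iff.mp ?_)⟩
  rw [← (genericPoint_spec Y).def]
  exact closure_mono (Set.singleton_subset_iff.mpr ⟨x, hx⟩)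

variable [IsIntegral X] [IsIntegral Y]

variable {f} in
theorem isDominant_of_fromSpecStalk_comp_eq {φ : Y.functionField ⟶ X.functionField}
    (h : X.fromSpecStalk (genericPoint X) ≫ f =
      Spec.map φ ≫ Y.fromSpecStalk (genericPoint Y)) : IsDominant f := by
  let x : Spec X.functionField := IsLocalRing.closedPoint X.functionField
  have hx : X.fromSpecStalk (genericPoint X) x = genericPoint X :=
    Scheme.fromSpecStalk_closedPoint
  have hφx : Spec.map φ x = IsLocalRing.closedPoint Y.functionField :=
    Subsingleton.elim (α := PrimeSpectrum _) _ _
  have hfx := congr($h x)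
  rw [Scheme.Hom.comp_apply, Scheme.Hom.comp_apply, hx, hφx] at hfx
  exact isDominant_of_apply_eq_genericPoint f (hfx.trans Scheme.fromSpecStalk_closedPoint)

variable [IsDominant f]

theorem functionFieldMap_germ {U : Y.Opens} (hY : genericPoint Y ∈ U)
    (hX : genericPoint X ∈ f ⁻¹ᵁ U) (s : Γ(Y, U)) :
    functionFieldMap f (Y.presheaf.germ U (genericPoint Y) hY s) =
      X.presheaf.germ (f ⁻¹ᵁ U) (genericPoint X) hX (f.app U s) := by
  have h : Y.presheaf.germ U (genericPoint Y) hY ≫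
      Y.presheaf.stalkSpecializes (specializes_of_eq (map_genericPoint f)) ≫
        f.stalkMap (genericPoint X) =
      f.app U ≫ X.presheaf.germ (f ⁻¹ᵁ U) (genericPoint X) hX := by
    rw [TopCat.Presheaf.germ_stalkSpecializes_assoc, Scheme.Hom.germ_stalkMap]
  exact congr(($h).hom s)

theorem functionFieldMap_comp_toFunctionField {k : Type u} [Field k] (s : Y ⟶ Spec (.of k)) :
    (functionFieldMap f).comp (toFunctionField s) = toFunctionField (f ≫ s) := by
  ext c
  refine (functionFieldMap_germ f (U := ⊤) trivial trivial
    (s.appTop ((Scheme.ΓSpecIso (.of k)).inv c))).trans ?_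
  rw [toFunctionField, Scheme.Hom.comp_appTop]
  rfl

theorem SpecMap_functionFieldMap_fromSpecStalk :
    Spec.map (CommRingCat.ofHom (functionFieldMap f)) ≫ Y.fromSpecStalk (genericPoint Y) =
      X.fromSpecStalk (genericPoint X) ≫ f := by
  simp only [functionFieldMap, CommRingCat.ofHom_hom]
  rw [Spec.map_comp_assoc, Scheme.SpecMap_stalkSpecializes_fromSpecStalk,
    Scheme.SpecMap_stalkMap_fromSpecStalk]

theorem bijective_functionFieldMap
    (hf : Function.Bijective (f.stalkMap (genericPoint X)).hom) :
    Function.Bijective (functionFieldMap f) := by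
  have h := (ConcreteCategory.isIso_iff_bijective _).mp
    (Y.presheaf.stalkCongr (.of_eq (map_genericPoint f))).isIso_inv
  exact hf.comp h

end FunctionFieldMap

section NormalSchemes

variable {X : Scheme.{u}} [IsIntegral X]

theorem exists_germToFunctionField_eq (U : X.Opens) [Nonempty U] (a : X.functionField)
    (ha : ∀ x ∈ U, a ∈ (algebraMap (X.presheaf.stalk x) X.functionField).range) :
    ∃ s, X.germToFunctionField U s = a := by
  have exists_local_section (x : U) : ∃ (V : X.Opens) (_ : V ≤ U) (_ : x.1 ∈ V) (s : Γ(X, V)),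
      ∀ h, X.presheaf.germ V (genericPoint X) h s = a := by
    obtain ⟨t, rfl⟩ := ha x x.2
    obtain ⟨V, hxV, s, rfl⟩ := X.presheaf.exists_germ_eq t
    have : Nonempty V := ⟨⟨x, hxV⟩⟩
    refine ⟨V ⊓ U, inf_le_right, ⟨hxV, x.2⟩, X.presheaf.map (homOfLE inf_le_left).op s,
      fun h ↦ ?_⟩
    rw [Scheme.algebraMap_germ_eq_germToFunctionField]
    exact X.presheaf.germ_res_apply _ _ _ _
  choose V hVU hxV s hs using exists_local_section
  have hη (x : U) : genericPoint X ∈ V x :=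
    ((genericPoint_spec X).mem_open_set_iff (V x).isOpen).mpr ⟨x, trivial, hxV x⟩
  have hcompat : TopCat.Presheaf.IsCompatible X.presheaf V s := by
    intro x y
    have hηxy : genericPoint X ∈ V x ⊓ V y := ⟨hη x, hη y⟩
    refine germ_injective_of_isIntegral (X := X) (genericPoint X) hηxy ?_
    exact (X.presheaf.germ_res_apply _ _ _ _).trans <|
      ((hs x _).trans (hs y _).symm).trans (X.presheaf.germ_res_apply _ _ _ _).symm
  obtain ⟨t, ht, -⟩ := X.sheaf.existsUnique_gluing' V U (fun x ↦ homOfLE (hVU x))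
    (fun x hx ↦ Opens.mem_iSup.mpr ⟨⟨x, hx⟩, hxV _⟩) s hcompat
  obtain ⟨x⟩ := ‹Nonempty U›
  refine ⟨t, ?_⟩
  rw [← hs x (hη x), ← ht x]
  exact (X.presheaf.germ_res_apply _ _ _ _).symm

theorem IsNormalScheme.isIntegrallyClosedIn_functionField (hX : IsNormalScheme X)
    (U : X.Opens) [Nonempty U] : IsIntegrallyClosedIn Γ(X, U) X.functionField := by
  refine isIntegrallyClosedIn_iff.mpr ⟨X.germToFunctionField_injective U, fun {a} ha ↦ ?_⟩
  refine exists_germToFunctionField_eq U a fun x hx ↦ ?_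
  have := hX.isIntegrallyClosed_stalk x
  let := X.presheaf.algebra_section_stalk ⟨x, hx⟩
  have := functionField_isScalarTower X U ⟨x, hx⟩
  exact IsIntegrallyClosed.isIntegral_iff.mp (ha.tower_top (A := X.presheaf.stalk x))

theorem IsNormalScheme.isIntegrallyClosed (hX : IsNormalScheme X) (U : X.Opens) [Nonempty U] :
    IsIntegrallyClosed Γ(X, U) := by
  have := hX.isIntegrallyClosedIn_functionField U
  have : FaithfulSMul Γ(X, U) X.functionField :=
    (faithfulSMul_iff_algebraMap_injective _ _).mpr (X.germToFunctionField_injective U)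
  exact .of_isIntegrallyClosedIn Γ(X, U) X.functionField

theorem IsNormalScheme.of_isAffineOpen
    (h : ∀ U : X.Opens, IsAffineOpen U → Nonempty U → IsIntegrallyClosed Γ(X, U)) :
    IsNormalScheme X := by
  refine ⟨fun x ↦ inferInstance, fun x ↦ ?_⟩
  obtain ⟨_, ⟨U, hU, rfl⟩, hxU, -⟩ :=
    X.isBasis_affineOpens.exists_subset_of_mem_open (Set.mem_univ x) isOpen_univ
  have : Nonempty U := ⟨⟨x, hxU⟩⟩
  have := h U hU this
  let := X.presheaf.algebra_section_stalk ⟨x, hxU⟩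
  have := hU.isLocalization_stalk ⟨x, hxU⟩
  exact isIntegrallyClosed_of_isLocalization _
    (hU.primeIdealOf ⟨x, hxU⟩).asIdeal.primeCompl (Ideal.primeCompl_le_nonZeroDivisors _)

end NormalSchemes

section Pushforward

variable {X Y : Scheme.{u}} {f : X ⟶ Y}

theorem PushforwardStructureSheafEq.nonempty_preimage (hf : PushforwardStructureSheafEq f)
    (U : Y.Opens) [Nonempty U] : Nonempty (f ⁻¹ᵁ U) := by
  by_contra hempty
  have hbot : f ⁻¹ᵁ U = ⊥ := by
    ext x
    exact ⟨fun hx ↦ hempty ⟨x, hx⟩, fun hx ↦ hx.elim⟩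
  have : Subsingleton Γ(X, f ⁻¹ᵁ U) := by rw [hbot]; infer_instance
  exact zero_ne_one (α := Γ(Y, U)) ((hf U).1 (Subsingleton.elim _ _))

theorem PushforwardStructureSheafEq.isDominant (hf : PushforwardStructureSheafEq f) :
    IsDominant f := by
  refine ⟨dense_iff_inter_open.mpr fun U hU hne ↦ ?_⟩
  have : Nonempty (⟨U, hU⟩ : Y.Opens) := hne.to_subtype
  obtain ⟨x, hx⟩ := hf.nonempty_preimage ⟨U, hU⟩
  exact ⟨f x, hx, x, rfl⟩

theorem PushforwardStructureSheafEq.isIntegral [IsIntegral X]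
    (hf : PushforwardStructureSheafEq f) : IsIntegral Y where
  nonempty := ⟨f (genericPoint X)⟩
  component_integral U _ :=
    have := hf.nonempty_preimage U
    (hf U).1.isDomain _

theorem PushforwardStructureSheafEq.isNormalScheme [IsIntegral X]
    (hf : PushforwardStructureSheafEq f) (hX : IsNormalScheme X) : IsNormalScheme Y := by
  have := hf.isIntegral
  refine .of_isAffineOpen fun U _ _ ↦ ?_
  have := hf.nonempty_preimage U
  have := hX.isIntegrallyClosed (f ⁻¹ᵁ U)
  exact .of_equiv (RingEquiv.ofBijective _ (hf U)).symm

theorem PushforwardStructureSheafEq.of_isBasis {B : Set Y.Opens} (hB : Opens.IsBasis B)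
    (hf : ∀ U ∈ B, Function.Bijective (f.app U).hom) : PushforwardStructureSheafEq f := by
  let φ : Y.sheaf ⟶ (TopCat.Sheaf.pushforward _ f.base).obj X.sheaf := ⟨f.c⟩
  have : IsIso φ := by
    refine TopCat.Sheaf.isIso_iff_isIso_basis (B := ((↑) : B → Y.Opens))
      (by rwa [Subtype.range_coe]) fun U ↦ ?_
    exact (ConcreteCategory.isIso_iff_bijective _).mpr (hf U U.2)
  have (U : Y.Opens) : IsIso (f.app U) :=
    inferInstanceAs (IsIso (((TopCat.Sheaf.forget _ _).map φ).app (.op U)))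
  exact fun U ↦ (ConcreteCategory.isIso_iff_bijective _).mp (this U)

theorem PushforwardStructureSheafEq.of_isPullback {X' Y' : Scheme.{u}} {g' : X' ⟶ X}
    {f' : X' ⟶ Y'} {g : Y' ⟶ Y} (H : IsPullback g' f' f g) [QuasiCompact f] [QuasiSeparated f]
    [Flat g] (hf : PushforwardStructureSheafEq f) : PushforwardStructureSheafEq f' := by
  let B : Set Y'.Opens := {W | IsAffineOpen W ∧ ∃ U : Y.Opens, IsAffineOpen U ∧ W ≤ g ⁻¹ᵁ U}
  have hB : Opens.IsBasis B := by
    refine Opens.isBasis_iff_nbhd.mpr fun {V y} hy ↦ ?_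
    obtain ⟨_, ⟨U, hU, rfl⟩, hyU, -⟩ :=
      Y.isBasis_affineOpens.exists_subset_of_mem_open (Set.mem_univ (g y)) isOpen_univ
    obtain ⟨W, hW, hyW, hWV⟩ :=
      Opens.isBasis_iff_nbhd.mp Y'.isBasis_affineOpens (U := V ⊓ g ⁻¹ᵁ U) ⟨hy, hyU⟩
    exact ⟨W, ⟨hW, U, hU, hWV.trans inf_le_right⟩, hyW, hWV.trans inf_le_left⟩
  refine .of_isBasis hB fun W ⟨hW, U, hU, hWU⟩ ↦ ?_
  have hpre : f' ⁻¹ᵁ W = g' ⁻¹ᵁ (f ⁻¹ᵁ U) ⊓ f' ⁻¹ᵁ W := by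
    rw [right_eq_inf, ← Scheme.Hom.comp_preimage, H.w, Scheme.Hom.comp_preimage]
    exact f'.preimage_mono hWU
  have hpushout := (isIso_pushoutSection_iff H hWU le_rfl hpre).mp <|
    isIso_pushoutSection_of_isQuasiSeparated_of_flat_right H hWU le_rfl hpre hU hW
      (f.isCompact_preimage hU.isCompact) (f.isQuasiSeparated_preimage hU.isQuasiSeparated)
  have : IsIso (f.appLE U (f ⁻¹ᵁ U) le_rfl) := by
    rw [← Scheme.Hom.app_eq_appLE]
    exact (ConcreteCategory.isIso_iff_bijective _).mpr (hf U)
  have hiso := hpushout.isIso_inr_of_isIso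
  rw [← Scheme.Hom.app_eq_appLE] at hiso
  exact (ConcreteCategory.isIso_iff_bijective _).mp hiso

end Pushforward

theorem algebraicallyClosedIn_toFunctionField_of_surjective_appTop {k : Type u} [Field k]
    {X Y : Scheme.{u}} [IsIntegral X] [IsIntegral Y] (f : X ⟶ Y) [IsDominant f]
    (hX : IsNormalScheme X) (hf : Function.Surjective f.appTop) {s : Y ⟶ Spec (.of k)}
    (hkY : AlgebraicallyClosedIn (toFunctionField s)) :
    AlgebraicallyClosedIn (toFunctionField (f ≫ s)) := by
  intro x hx
  have : Nonempty (⊤ : X.Opens) := ⟨⟨genericPoint X, trivial⟩⟩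
  have := hX.isIntegrallyClosedIn_functionField ⊤
  have hint : IsIntegral Γ(X, ⊤) x :=
    (algebraicElem_iff_isIntegralElem.mp hx : ((X.germToFunctionField ⊤).hom.comp
      ((Scheme.ΓSpecIso (.of k)).inv ≫ (f ≫ s).appTop).hom).IsIntegralElem x).of_comp
  obtain ⟨t, rfl⟩ := IsIntegrallyClosedIn.algebraMap_eq_of_integral hint
  obtain ⟨t, rfl⟩ := hf t
  let y := Y.presheaf.germ ⊤ (genericPoint Y) trivial t
  have hy : functionFieldMap f y = algebraMap Γ(X, ⊤) X.functionField (f.appTop t) :=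
    functionFieldMap_germ f (U := ⊤) trivial trivial t
  rw [← hy, ← functionFieldMap_comp_toFunctionField] at hx ⊢
  obtain ⟨c, hc⟩ := hkY y ((algebraicElem_map_iff _).mp hx)
  exact ⟨c, congrArg (functionFieldMap f) hc⟩

section Lifting

theorem isIso_fromNormalization_of_isIntegrallyClosedIn {X Y : Scheme.{u}} (f : X ⟶ Y)
    [QuasiCompact f] [QuasiSeparated f]
    (hf : ∀ U : Y.Opens, IsAffineOpen U →
      letI := (f.app U).hom.toAlgebra
      IsIntegrallyClosedIn Γ(Y, U) Γ(X, f ⁻¹ᵁ U)) :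
    IsIso f.fromNormalization := by
  refine (IsZariskiLocalAtTarget.iff_of_iSup_eq_top (P := .isomorphisms Scheme) _
    (iSup_affineOpens_eq_top Y)).mpr fun ⟨U, hU⟩ ↦ ?_
  refine (isIso_morphismRestrict_iff_isIso_app _ hU).mpr ?_
  let := (f.app U).hom.toAlgebra
  obtain ⟨hinj, hsurj⟩ := isIntegrallyClosedIn_iff.mp (hf U hU)
  have : IsIso (CommRingCat.ofHom
      (algebraMap Γ(Y, U) (integralClosure Γ(Y, U) Γ(X, f ⁻¹ᵁ U)))) :=
    (ConcreteCategory.isIso_iff_bijective _).mpr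
      ⟨fun a b hab ↦ hinj (congrArg Subtype.val hab),
        fun ⟨y, hy⟩ ↦ (hsurj hy).imp fun _ ↦ Subtype.ext⟩
  rw [Scheme.Hom.fromNormalization_app _ hU]
  infer_instance

theorem hasLiftingProperty_of_isIso_fromNormalization {W X T S : Scheme.{u}} (i : W ⟶ X)
    [QuasiCompact i] [QuasiSeparated i] [IsIso i.fromNormalization] (ν : T ⟶ S)
    [IsIntegralHom ν] : HasLiftingProperty i ν where
  sq_hasLift {g h} sq := by
    -- The base change of `ν` to `X` is integral, and `i` factors through it.
    let s : W ⟶ pullback h ν := pullback.lift i g sq.w.symm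
    have hs : i = s ≫ pullback.fst h ν := (pullback.lift_fst _ _ _).symm
    have hi : i ≫ inv i.fromNormalization = i.toNormalization := by
      rw [IsIso.comp_inv_eq, i.toNormalization_fromNormalization]
    refine ⟨⟨⟨inv i.fromNormalization ≫ i.normalizationDesc s (pullback.fst h ν) hs ≫
      pullback.snd h ν, ?_, ?_⟩⟩⟩
    · rw [reassoc_of% hi, Scheme.Hom.toNormalization_normalizationDesc_assoc]
      exact pullback.lift_snd _ _ _
    · rw [Category.assoc, Category.assoc, ← pullback.condition,
        Scheme.Hom.normalizationDesc_comp_assoc, IsIso.inv_hom_id_assoc]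

variable {X : Scheme.{u}} [IsIntegral X]

theorem IsNormalScheme.isIso_fromNormalization_fromSpecStalk (hX : IsNormalScheme X) :
    IsIso (X.fromSpecStalk (genericPoint X)).fromNormalization := by
  set g := X.fromSpecStalk (genericPoint X)
  refine isIso_fromNormalization_of_isIntegrallyClosedIn g fun U _ ↦ ?_
  let := (g.app U).hom.toAlgebra
  rcases eq_or_ne U ⊥ with rfl | hne
  · have : Subsingleton Γ(Spec X.functionField, g ⁻¹ᵁ ⊥) :=
      inferInstanceAs (Subsingleton Γ(Spec X.functionField, ⊥))
    exact isIntegrallyClosedIn_iff.mpr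
      ⟨Function.injective_of_subsingleton _, fun _ ↦ ⟨0, Subsingleton.elim _ _⟩⟩
  have : Nonempty U := (Opens.ne_bot_iff_nonempty U).mp hne |>.to_subtype
  have hηU : genericPoint X ∈ U :=
    ((genericPoint_spec X).mem_open_set_iff U.isOpen).mpr ⟨_, trivial, this.some.2⟩
  have htop : g ⁻¹ᵁ U = ⊤ := by
    refine Scheme.preimage_eq_top_of_closedPoint_mem g ?_
    rwa [Scheme.fromSpecStalk_closedPoint]
  let e : X.functionField ≅ Γ(Spec X.functionField, g ⁻¹ᵁ U) :=
    (Scheme.ΓSpecIso X.functionField).symm ≪≫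
      (Spec X.functionField).presheaf.mapIso (eqToIso htop).op
  have happ : g.app U = X.germToFunctionField U ≫ e.hom := Scheme.fromSpecStalk_app hηU
  let eAlg : X.functionField ≃ₐ[Γ(X, U)] Γ(Spec X.functionField, g ⁻¹ᵁ U) :=
    { e.commRingCatIsoToRingEquiv with commutes' := fun s ↦ congr(($happ).hom s).symm }
  have := hX.isIntegrallyClosedIn_functionField U
  exact eAlg.isIntegrallyClosedIn.mp this

theorem IsNormalScheme.exists_isDominant_lift {Z' Z : Scheme.{u}} [IsIntegral Z'] [IsIntegral Z]
    (hX : IsNormalScheme X) {ν : Z' ⟶ Z} [IsIntegralHom ν] [IsDominant ν]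
    (hν : Function.Bijective (functionFieldMap ν)) (h : X ⟶ Z) [IsDominant h] :
    ∃ h' : X ⟶ Z', IsDominant h' ∧ h' ≫ ν = h := by
  have := hX.isIso_fromNormalization_fromSpecStalk
  have := hasLiftingProperty_of_isIso_fromNormalization (X.fromSpecStalk (genericPoint X)) ν
  let νK : Z.functionField ⟶ Z'.functionField := CommRingCat.ofHom (functionFieldMap ν)
  have : IsIso νK := (ConcreteCategory.isIso_iff_bijective _).mpr hν
  let φ : Z'.functionField ⟶ X.functionField := inv νK ≫ CommRingCat.ofHom (functionFieldMap h)
  have hφ : νK ≫ φ = CommRingCat.ofHom (functionFieldMap h) := IsIso.hom_inv_id_assoc _ _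
  let g : Spec X.functionField ⟶ Z' := Spec.map φ ≫ Z'.fromSpecStalk (genericPoint Z')
  have sq : CommSq g (X.fromSpecStalk (genericPoint X)) ν h := by
    constructor
    rw [← SpecMap_functionFieldMap_fromSpecStalk h, Category.assoc,
      ← SpecMap_functionFieldMap_fromSpecStalk ν, ← Spec.map_comp_assoc]
    exact congr(Spec.map $hφ ≫ _)
  exact ⟨sq.lift, isDominant_of_fromSpecStalk_comp_eq sq.fac_left, sq.fac_right⟩

end Lifting

section BaseChange

variable {k : Type u} [Field k] (l : Type u) [Field l] [Algebra k l] {X Y : Scheme.{u}}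
  {sX : X ⟶ Spec (.of k)} {sY : Y ⟶ Spec (.of k)}

instance flat_baseChangeFst : Flat (baseChangeFst l sX) := by
  have : Flat (Spec.map (CommRingCat.ofHom (algebraMap k l))) :=
    (HasRingHomProperty.Spec_iff (P := @Flat)).mpr (RingHom.flat_algebraMap_iff.mpr inferInstance)
  infer_instance

theorem isPullback_baseChangeMap (f : X ⟶ Y) (hf : f ≫ sY = sX) :
    IsPullback (baseChangeFst l sX) (baseChangeMap l f hf) f (baseChangeFst l sY) := by
  refine .of_bot (v₂₁ := baseChangeSnd l sY) (v₂₂ := sY)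
    (h₃₁ := Spec.map (CommRingCat.ofHom (algebraMap k l))) ?_ ?_ (.of_hasPullback _ _)
  · rw [hf, baseChangeMap, pullback.lift_snd]
    exact .of_hasPullback _ _
  · rw [baseChangeMap, pullback.lift_fst]

end BaseChange

end ElementalExt

open ElementalExt in
theorem mainTheorem9_general {k : Type u} [Field k] {X Y : Scheme.{u}} [IsIntegral X]
    [IsIntegral Y] (sX : X ⟶ Spec (.of k)) (sY : Y ⟶ Spec (.of k)) (hX : IsNormalScheme X)
    (f : X ⟶ Y) (hf : f ≫ sY = sX) [QuasiCompact f] [QuasiSeparated f]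
    (hfO : PushforwardStructureSheafEq f) (hkY : AlgebraicallyClosedIn (toFunctionField sY)) :
    AlgebraicallyClosedIn (toFunctionField sX) ∧
    ∀ (l : Type u) [Field l] [Algebra k l] [IsIntegral (baseChange l sX)],
      IsIntegral (baseChange l sY) ∧
      (∀ {kX' kY' : Type u} [Field kX'] [Field kY'] [Algebra l kX'] [Algebra l kY']
        {X' Y' : Scheme.{u}} [IsIntegral X'] [IsIntegral Y'] (νX : X' ⟶ baseChange l sX)
        (νY : Y' ⟶ baseChange l sY) (ιX : kX' →+* X'.functionField)
        (ιY : kY' →+* Y'.functionField), IsNormalisation νX →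
        IsAlgebraicClosureIn (toFunctionField (νX ≫ baseChangeSnd l sX)) ιX →
        IsNormalisation νY →
        IsAlgebraicClosureIn (toFunctionField (νY ≫ baseChangeSnd l sY)) ιY →
        ∃ (f' : X' ⟶ Y') (_ : IsDominant f'), f' ≫ νY = νX ≫ baseChangeMap l f hf ∧
          ∃ j : kY' →ₐ[l] kX', ∀ a, ιX (j a) = functionFieldMap f' (ιY a)) ∧
      (IsNormalScheme (baseChange l sX) → IsNormalScheme (baseChange l sY)) := by
  have := hfO.isDominant
  refine ⟨hf ▸ algebraicallyClosedIn_toFunctionField_of_surjective_appTop f hX (hfO ⊤).2 hkY, ?_⟩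
  intro l _ _ _
  have hfl := hfO.of_isPullback (isPullback_baseChangeMap l f hf)
  have := hfl.isIntegral
  have := hfl.isDominant
  refine ⟨hfl.isIntegral, fun {kX' kY'} _ _ _ _ {X' Y'} _ _ νX νY ιX ιY hνX hιX hνY hιY ↦ ?_,
    hfl.isNormalScheme⟩
  have := hνX.isDominant
  have := hνY.isDominant
  have := hνY.isIntegralHom
  obtain ⟨f', hf', hlift⟩ := hνX.isNormalScheme.exists_isDominant_lift
    (bijective_functionFieldMap νY hνY.bijective_functionField) (νX ≫ baseChangeMap l f hf)
  have hsnd : f' ≫ νY ≫ baseChangeSnd l sY = νX ≫ baseChangeSnd l sX := by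
    rw [reassoc_of% hlift, baseChangeMap, pullback.lift_snd]
  rw [← hsnd, ← functionFieldMap_comp_toFunctionField] at hιX
  exact ⟨f', hf', hlift, hιY.exists_algHom hιX⟩

theorem mainTheorem9 (p : ℕ) (hp : p.Prime) {k : Type u} [Field k] [CharP k p]
    {X Y : Scheme.{u}} [IsIntegral X] [IsIntegral Y]
    (sX : X ⟶ Spec (.of k)) (sY : Y ⟶ Spec (.of k))
    [IsSeparated sX] [LocallyOfFiniteType sX] [QuasiCompact sX]
    [IsSeparated sY] [LocallyOfFiniteType sY] [QuasiCompact sY]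
    (hX : ElementalExt.IsNormalScheme X) (hY : ElementalExt.IsNormalScheme Y)
    (f : X ⟶ Y) (hf : f ≫ sY = sX) [IsProper f]
    (hfO : ElementalExt.PushforwardStructureSheafEq f)
    (hkY : ElementalExt.AlgebraicallyClosedIn (ElementalExt.toFunctionField sY)) :
    ElementalExt.AlgebraicallyClosedIn (ElementalExt.toFunctionField sX) ∧
    ∀ {l kX' : Type u} [Field l] [Field kX'] [Algebra k l] [Algebra l kX']
      {X' : Scheme.{u}} [IsIntegral X'] (φ : X' ⟶ X)
      (νX : X' ⟶ ElementalExt.baseChange l sX) (ιX : kX' →+* X'.functionField),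
      ElementalExt.IsElementalExtension p sX φ νX ιX →
      IsIntegral (ElementalExt.baseChange l sY) ∧
      (∀ {kY' : Type u} [Field kY'] [Algebra l kY'] {Y' : Scheme.{u}} [IsIntegral Y']
        (νY : Y' ⟶ ElementalExt.baseChange l sY) (ιY : kY' →+* Y'.functionField),
        ElementalExt.IsNormalisation νY →
        ElementalExt.IsAlgebraicClosureIn
          (ElementalExt.toFunctionField (νY ≫ ElementalExt.baseChangeSnd l sY)) ιY →
        ElementalExt.IsElementalExtension p sY
          (νY ≫ ElementalExt.baseChangeFst l sY) νY ιY ∧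
        -- the inclusion `k_{Y'} ⊂ k_{X'}` over `l`, inside `K(Y') ⊂ K(X')`
        ∃ (f' : X' ⟶ Y') (_ : IsDominant f'),
          f' ≫ νY = νX ≫ ElementalExt.baseChangeMap l f hf ∧
          ∃ j : kY' →ₐ[l] kX', ∀ a : kY',
            ιX (j a) = ElementalExt.functionFieldMap f' (ιY a)) ∧
      (¬ ElementalExt.IsNormalScheme (ElementalExt.baseChange l sY) →
        ¬ ElementalExt.IsNormalScheme (ElementalExt.baseChange l sX)) := by
  obtain ⟨hkX, hbaseChange⟩ := mainTheorem9_general sX sY hX f hf hfO hkY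
  refine ⟨hkX, ?_⟩
  intro l kX' _ _ _ _ X' _ φ νX ιX hE
  have := hE.isIntegral_baseChange
  obtain ⟨hYl, hlift, hnormal⟩ := hbaseChange l
  exact ⟨hYl, fun νY ιY hνY hιY ↦
    ⟨⟨hE.isPurelyInseparable, hE.pow_mem, hYl, hνY, rfl, hιY⟩,
      hlift νX νY ιX ιY hE.isNormalisation hE.isAlgebraicClosureIn hνY hιY⟩, mt hnormal⟩
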